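/- Let $\mathbb{K}$ be a field, let $n$ be a natural number, and let $\Delta$ be a nonempty simplicial complex on $[n]=\{1,\dots,n\}$, i.e. a nonempty collection of subsets of $[n]$ (called faces) closed under taking subsets; not every singleton has to be a face. Call $\Delta$ a matroid if for all $I,J\in\Delta$ with $\#J<\#I$ there is $v\in I\setminus J$ with $J\cup\{v\}\in\Delta$. A minimal nonface of $\Delta$ is a set $C\subseteq[n]$ with $C\notin\Delta$ all of whose proper subsets lie in $\Delta$; for $i\in[n]$ let $\mathcal{C}_\Delta(i)$ be the set of minimal nonfaces containing $i$. Let $S=\mathbb{K}[x_1,\dots,x_n]$ with its $\mathbb{Z}^n$-grading, let $I_\Delta=\langle \prod_{i\in F}x_i : F\subseteq[n],\ F\notin\Delta\rangle$ be the Stanley–Reisner ideal, and let the first cotangent cohomology module $T^1(\Delta)$ be the cokernel of the natural map $\operatorname{Der}_{\mathbb{K}}(S,S)\to\operatorname{Hom}_S(I_\Delta,S/I_\Delta)$, $\partial\mapsto(f\mapsto \partial f \bmod I_\Delta)$. It is $\mathbb{Z}^n$-graded; $T^1_{\mathbf{c}}(\Delta)$ denotes its component of degree $\mathbf{c}\in\mathbb{Z}^n$,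 that is, the image of the $S$-homomorphisms $I_\Delta\to S/I_\Delta$ that are homogeneous of degree $\mathbf{c}$. Let $e_1,\dots,e_n$ be the standard basis of $\mathbb{Z}^n$. Then $\Delta$ is a matroid if and only if $$\dim_{\mathbb{K}} T^1_{-e_i}(\Delta)=\max\{\#\mathcal{C}_\Delta(i)-1,\,0\}\qquad\text{for every } i=1,\dots,n.$$ -/

import Mathlib

open MvPolynomial

namespace CotangentMatroid

/-- A simplicial complex on the vertex set `Fin n`: a collection of subsets of `Fin n` closed under
taking subsets. (The empty set may be a face, and singletons need not be faces.) -/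
abbrev Complex (n : ℕ) : Type := LowerSet (Finset (Fin n))

/-- A matroid, given by its independent sets: a nonempty simplicial complex whose faces satisfy the
exchange property. -/
def IsMatroid {n : ℕ} (Δ : Complex n) : Prop :=
  (Δ : Set (Finset (Fin n))).Nonempty ∧
    ∀ I ∈ Δ, ∀ J ∈ Δ, J.card < I.card → ∃ v ∈ I \ J, insert v J ∈ Δ

/-- The set of minimal nonfaces of `Δ`. -/
def minNonfaces {n : ℕ} (Δ : Complex n) : Set (Finset (Fin n)) :=
  {C | C ∉ Δ ∧ ∀ D, D ⊂ C → D ∈ Δ}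

/-- The set of minimal nonfaces of `Δ` that contain the set `b`. -/
def minNonfacesContaining {n : ℕ} (Δ : Complex n) (b : Finset (Fin n)) :
    Set (Finset (Fin n)) :=
  {C | C ∈ minNonfaces Δ ∧ b ⊆ C}

section Algebra

variable (K : Type*) [Field K] {n : ℕ}

/-- The Stanley-Reisner ideal of `Δ` in `K[x_1, …, x_n]`. -/
noncomputable def stanleyReisnerIdeal (Δ : Complex n) : Ideal (MvPolynomial (Fin n) K) :=
  Ideal.span {f | ∃ F : Finset (Fin n), F ∉ Δ ∧ f = ∏ i ∈ F, X i}

variable {K}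

/-- The natural map `Der_K(S, S) → Hom_S(I, S/I)`, `∂ ↦ (f ↦ ∂ f mod I)`. -/
noncomputable def derToHom (I : Ideal (MvPolynomial (Fin n) K)) :
    Derivation K (MvPolynomial (Fin n) K) (MvPolynomial (Fin n) K)
      →ₗ[MvPolynomial (Fin n) K] (I →ₗ[MvPolynomial (Fin n) K] MvPolynomial (Fin n) K ⧸ I) where
  toFun D :=
    { toFun := fun f => Ideal.Quotient.mk I (D f)
      map_add' := fun f g => by simp
      map_smul' := fun s f => by
        have h : Ideal.Quotient.mk I ((f : MvPolynomial (Fin n) K) * D s) = 0 :=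
          Ideal.Quotient.eq_zero_iff_mem.mpr (I.mul_mem_right _ f.2)
        simp only [SetLike.val_smul, smul_eq_mul, Derivation.leibniz, map_add, h, add_zero,
          RingHom.id_apply]
        rfl }
  map_add' D E := by ext f; simp
  map_smul' s D := by ext f; rfl

/-- The first cotangent cohomology module `T¹(S/I)`: the cokernel of
`Der_K(S, S) → Hom_S(I, S/I)`. -/
abbrev T1 (I : Ideal (MvPolynomial (Fin n) K)) : Type _ :=
  (I →ₗ[MvPolynomial (Fin n) K] MvPolynomial (Fin n) K ⧸ I) ⧸ LinearMap.range (derToHom I)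

variable (K) in
/-- The component `S_d` of `S = K[x_1, …, x_n]` in degree `d ∈ ℤⁿ` (zero unless all `d i ≥ 0`). -/
noncomputable def polyComponent (d : Fin n → ℤ) : Submodule K (MvPolynomial (Fin n) K) :=
  Submodule.span K {f | ∃ a : Fin n →₀ ℕ, (∀ i, (a i : ℤ) = d i) ∧ f = monomial a 1}

/-- The component `(S/I)_d` in degree `d ∈ ℤⁿ`: the image of `S_d` (for `I` a monomial ideal). -/
noncomputable def quotComponent (I : Ideal (MvPolynomial (Fin n) K)) (d : Fin n → ℤ) :
    Submodule K (MvPolynomial (Fin n) K ⧸ I) :=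
  (polyComponent K d).map (Ideal.Quotient.mkₐ K I).toLinearMap

/-- The component `Hom_S(I, S/I)_c` in degree `c ∈ ℤⁿ`: the homomorphisms that map `I ∩ S_d` into
`(S/I)_{d + c}` for every `d` (for `I` a monomial ideal). -/
noncomputable def homComponent (I : Ideal (MvPolynomial (Fin n) K)) (c : Fin n → ℤ) :
    Submodule K (I →ₗ[MvPolynomial (Fin n) K] MvPolynomial (Fin n) K ⧸ I) where
  carrier := {φ | ∀ (d : Fin n → ℤ) (f : I), (f : MvPolynomial (Fin n) K) ∈ polyComponent K d →
    φ f ∈ quotComponent I (d + c)}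
  add_mem' hφ hψ d f hf := (quotComponent I (d + c)).add_mem (hφ d f hf) (hψ d f hf)
  zero_mem' d _ _ := (quotComponent I (d + c)).zero_mem
  smul_mem' r _ hφ d f hf := (quotComponent I (d + c)).smul_mem r (hφ d f hf)

/-- The component `T¹_c(S/I)` in degree `c ∈ ℤⁿ`: the image of `Hom_S(I, S/I)_c` in the quotient
`T¹(S/I)` (for `I` a monomial ideal). -/
noncomputable def T1Component (I : Ideal (MvPolynomial (Fin n) K)) (c : Fin n → ℤ) :
    Submodule K (T1 I) :=
  (homComponent I c).map
    ((LinearMap.range (derToHom I)).mkQ.restrictScalars K)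

end Algebra

end CotangentMatroid

namespace CotangentMatroid

/-! ### Circuit elimination -/

/-! Call minimal nonfaces circuits and write `x_F` for the squarefree monomial of `F`. A
homomorphism of degree `-e_i` sends `x_C` to `λ_C x_{C \ i}` for a circuit `C` through `i`, and to
zero for the other circuits. The vector `λ`, given by `leadCoeffs`, determines it
(`eq_zero_of_leadCoeffs_eq_zero`). Derivations contribute exactly the constant vectors, spanned by
the image of `∂/∂x_i` (`leadCoeffs_derToHom`). So, if some circuit contains `i`, the dimension
attains `#C(i) - 1` iff every vector `λ` occurs.

By `map_leadCoeffs_eq_top_iff` this happens iff `(C ∪ D) \ i` is a nonface for all distinct circuits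
`C`, `D` through `i`: a face `(C ∪ D) \ i` forces `λ_C = λ_D`, and without such faces each `λ_C` can
be chosen freely. Required at every `i`, this is circuit elimination, which characterises matroids.
-/

/-- Circuit elimination at the element `i`. -/
def EliminationAt {n : ℕ} (Δ : Complex n) (i : Fin n) : Prop :=
  ∀ C ∈ minNonfaces Δ, ∀ D ∈ minNonfaces Δ, i ∈ C → i ∈ D → C ≠ D → (C ∪ D).erase i ∉ Δ

lemma exists_minNonface_subset {n : ℕ} {Δ : Complex n} {F : Finset (Fin n)} (hF : F ∉ Δ) :
    ∃ C ∈ minNonfaces Δ, C ⊆ F := by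
  induction F using Finset.strongInduction with
  | H F ih =>
    by_cases h : ∀ D, D ⊂ F → D ∈ Δ
    · exact ⟨F, ⟨hF, h⟩, subset_rfl⟩
    · push Not at h
      obtain ⟨D, hDF, hD⟩ := h
      obtain ⟨C, hC, hCD⟩ := ih D hDF hD
      exact ⟨C, hC, hCD.trans hDF.subset⟩

lemma minNonface_eq_of_subset {n : ℕ} {Δ : Complex n} {C D : Finset (Fin n)}
    (hC : C ∈ minNonfaces Δ) (hD : D ∉ Δ) (h : D ⊆ C) : D = C := by
  by_contra hne
  exact hD (hC.2 D (h.ssubset_of_ne hne))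

/-- For `f ∈ D \ C`, take a largest face `J` with `D \ f ⊆ J ⊆ C ∪ D`. It misses `f` and some `g ∈
C`, so it is smaller than `(C ∪ D) \ i`. If the latter were a face, exchange would enlarge `J`. -/
lemma IsMatroid.eliminationAt {n : ℕ} {Δ : Complex n} (hM : IsMatroid Δ) (i : Fin n) :
    EliminationAt Δ i := by
  classical
  intro C hC D hD hiC hiD hne hU
  have hDC : ¬ D ⊆ C := fun h => hne (minNonface_eq_of_subset hC hD.1 h).symm
  obtain ⟨f, hfD, hfC⟩ := Finset.not_subset.1 hDC
  have hS : D.erase f ∈ (C ∪ D).powerset.filter (fun J => J ∈ Δ ∧ D.erase f ⊆ J) := by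
    simp only [Finset.mem_filter, Finset.mem_powerset]
    exact ⟨(Finset.erase_subset _ _).trans Finset.subset_union_right,
      hD.2 _ (Finset.erase_ssubset hfD), subset_rfl⟩
  obtain ⟨J, hJ, hmax⟩ := Finset.exists_max_image
    ((C ∪ D).powerset.filter (fun J => J ∈ Δ ∧ D.erase f ⊆ J)) Finset.card ⟨_, hS⟩
  simp only [Finset.mem_filter, Finset.mem_powerset] at hJ hmax
  obtain ⟨hJU, hJΔ, hDJ⟩ := hJ
  have hfJ : f ∉ J := fun hf => hD.1 <| Δ.lower (fun x hx => by
    by_cases h : x = f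
    · exact h ▸ hf
    · exact hDJ (Finset.mem_erase.2 ⟨h, hx⟩)) hJΔ
  have hCJ : ¬ C ⊆ J := fun h => hC.1 (Δ.lower h hJΔ)
  obtain ⟨g, hgC, hgJ⟩ := Finset.not_subset.1 hCJ
  have hfg : f ≠ g := fun h => hfC (h ▸ hgC)
  have hsub : J ⊆ ((C ∪ D).erase f).erase g := fun x hx =>
    Finset.mem_erase.2 ⟨fun h => hgJ (h ▸ hx),
      Finset.mem_erase.2 ⟨fun h => hfJ (h ▸ hx), hJU hx⟩⟩
  have hg : g ∈ (C ∪ D).erase f :=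
    Finset.mem_erase.2 ⟨hfg.symm, Finset.mem_union_left _ hgC⟩
  have h1 := Finset.card_le_card hsub
  have h2 := Finset.card_erase_add_one hg
  have h3 := Finset.card_erase_add_one (Finset.mem_union_right C hfD)
  have h4 := Finset.card_erase_add_one (Finset.mem_union_left D hiC)
  obtain ⟨v, hv, hvΔ⟩ := hM.2 _ hU J hJΔ (by omega)
  rw [Finset.mem_sdiff] at hv
  have h5 := hmax (insert v J) ⟨Finset.insert_subset (Finset.mem_of_mem_erase hv.1) hJU, hvΔ,
    hDJ.trans (Finset.subset_insert _ _)⟩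
  rw [Finset.card_insert_of_notMem hv.2] at h5
  omega

/-- Among the faces in `I ∪ J` larger than `J`, take `L` with `J \ L` smallest. If `J ⊆ L`, any
element of `L \ J` serves. Otherwise fix `e ∈ J \ L`. Swapping any `f ∈ L \ J` for `e` must leave
`Δ`, which yields circuits through `e`; eliminating `e` from two of them gives a nonface inside `L`.
-/
lemma isMatroid_of_eliminationAt {n : ℕ} {Δ : Complex n}
    (hΔ : (Δ : Set (Finset (Fin n))).Nonempty) (h : ∀ i, EliminationAt Δ i) : IsMatroid Δ := by
  classical
  refine ⟨hΔ, fun I hI J hJ hcard => ?_⟩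
  obtain ⟨L, hL, hmin⟩ := Finset.exists_min_image
    ((I ∪ J).powerset.filter (fun L => L ∈ Δ ∧ J.card < L.card)) (fun L => (J \ L).card)
    ⟨I, by simpa only [Finset.mem_filter, Finset.mem_powerset] using
      ⟨Finset.subset_union_left, hI, hcard⟩⟩
  simp only [Finset.mem_filter, Finset.mem_powerset] at hL hmin
  obtain ⟨hLU, hLΔ, hJL⟩ := hL
  obtain ⟨g, hgL, hgJ⟩ := Finset.exists_mem_notMem_of_card_lt_card hJL
  by_cases hsub : J ⊆ L
  · refine ⟨g, Finset.mem_sdiff.2 ⟨?_, hgJ⟩, Δ.lower (Finset.insert_subset hgL hsub) hLΔ⟩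
    exact (Finset.mem_union.1 (hLU hgL)).resolve_right hgJ
  exfalso
  obtain ⟨e, heJ, heL⟩ := Finset.not_subset.1 hsub
  have key : ∀ f ∈ L, f ∉ J → ∃ C ∈ minNonfaces Δ, C ⊆ insert e (L.erase f) ∧ e ∈ C := by
    intro f hfL hfJ
    have hnot : insert e (L.erase f) ∉ Δ := by
      intro hmem
      have h1 := hmin (insert e (L.erase f)) ⟨Finset.insert_subset
        (Finset.mem_union_right _ heJ) ((Finset.erase_subset _ _).trans hLU), hmem, by
          rw [Finset.card_insert_of_notMem (fun h => heL (Finset.mem_of_mem_erase h)),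
            Finset.card_erase_add_one hfL]
          exact hJL⟩
      refine absurd h1 (not_le.2 (Finset.card_lt_card ?_))
      refine Finset.ssubset_iff_subset_ne.2 ⟨fun x hx => ?_, fun heq => ?_⟩
      · rw [Finset.mem_sdiff, Finset.mem_insert, Finset.mem_erase] at hx
        refine Finset.mem_sdiff.2 ⟨hx.1, fun hxL => hx.2 (Or.inr ⟨?_, hxL⟩)⟩
        rintro rfl
        exact hfJ hx.1
      · have : e ∈ J \ L := Finset.mem_sdiff.2 ⟨heJ, heL⟩
        rw [← heq, Finset.mem_sdiff] at this
        exact this.2 (Finset.mem_insert_self _ _)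
    obtain ⟨C, hC, hCs⟩ := exists_minNonface_subset hnot
    refine ⟨C, hC, hCs, ?_⟩
    by_contra heC
    refine hC.1 (Δ.lower (fun x hx => ?_) hLΔ)
    rcases Finset.mem_insert.1 (hCs hx) with rfl | hx'
    · exact absurd hx heC
    · exact Finset.mem_of_mem_erase hx'
  obtain ⟨C, hC, hCs, heC⟩ := key g hgL hgJ
  have hCJ : ¬ C ⊆ J := fun hs => hC.1 (Δ.lower hs hJ)
  -- Choosing `f` in the first circuit makes the second one, which avoids `f`, different from it.
  obtain ⟨f, hfC, hfJ⟩ := Finset.not_subset.1 hCJ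
  have hfe : f ≠ e := fun h => hfJ (h ▸ heJ)
  have hfL : f ∈ L :=
    Finset.mem_of_mem_erase ((Finset.mem_insert.1 (hCs hfC)).resolve_left hfe)
  obtain ⟨D, hD, hDs, heD⟩ := key f hfL hfJ
  have hfD : f ∉ D := fun hf => by
    simpa [hfe] using hDs hf
  refine h e C hC D hD heC heD (fun heq => hfD (heq ▸ hfC)) (Δ.lower (fun x hx => ?_) hLΔ)
  rw [Finset.mem_erase, Finset.mem_union] at hx
  rcases hx.2 with hx' | hx'
  · exact Finset.mem_of_mem_erase ((Finset.mem_insert.1 (hCs hx')).resolve_left hx.1)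
  · exact Finset.mem_of_mem_erase ((Finset.mem_insert.1 (hDs hx')).resolve_left hx.1)

/-! ### Ranks of images -/

/-- Rank–nullity for `q` on `H`, with the kernel identified through `l` with the line of `l d`.
Since `hq` covers all of `ker q`, inhomogeneous derivations need no decomposition into degrees. The
span is kept because `l d` vanishes when no circuit contains `i`. -/
lemma rank_map_add_finrank_span {K V W Q : Type*} [Field K] [AddCommGroup V] [Module K V]
    [AddCommGroup W] [Module K W] [AddCommGroup Q] [Module K Q] [FiniteDimensional K W]
    (q : V →ₗ[K] Q) (l : V →ₗ[K] W) (H : Submodule K V) (hl : ∀ v ∈ H, l v = 0 → v = 0)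
    (d : V) (hd : d ∈ H) (hqd : q d = 0) (hq : ∀ v, q v = 0 → l v ∈ Submodule.span K {l d}) :
    ∃ r : ℕ, Module.rank K (H.map q) = r ∧
      r + Module.finrank K (Submodule.span K {l d}) = Module.finrank K (H.map l) := by
  have hinj : Function.Injective (l.domRestrict H) := by
    rw [injective_iff_map_eq_zero]
    exact fun v hv => Subtype.ext (hl v v.2 hv)
  have hfin : FiniteDimensional K H := FiniteDimensional.of_injective _ hinj
  have h1 : Module.finrank K (H.map l) = Module.finrank K H := by
    rw [← LinearMap.range_domRestrict]
    exact LinearMap.finrank_range_of_inj hinj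
  have h2 : (LinearMap.ker (q.domRestrict H)).map (l.domRestrict H) =
      Submodule.span K {l d} := by
    apply le_antisymm
    · rintro _ ⟨v, hv, rfl⟩
      exact hq v hv
    · rw [Submodule.span_singleton_le_iff_mem]
      exact ⟨⟨d, hd⟩, hqd, rfl⟩
  have h3 : Module.finrank K (Submodule.span K {l d}) =
      Module.finrank K (LinearMap.ker (q.domRestrict H)) := by
    rw [← h2]
    exact (Submodule.equivMapOfInjective _ hinj _).finrank_eq.symm
  have h4 := (q.domRestrict H).finrank_range_add_finrank_ker
  rw [LinearMap.range_domRestrict] at h4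
  refine ⟨Module.finrank K (H.map q), (Module.finrank_eq_rank K _).symm, ?_⟩
  rw [h3, h1, h4]

/-! ### Monomials of the Stanley–Reisner ideal -/

section Algebra

variable {K : Type*} [Field K] {n : ℕ}

/-- The exponent vector of the squarefree monomial with support `F`. -/
noncomputable def sqfreeExp (F : Finset (Fin n)) : Fin n →₀ ℕ := ∑ j ∈ F, Finsupp.single j 1

lemma sqfreeExp_apply (F : Finset (Fin n)) (j : Fin n) :
    sqfreeExp F j = if j ∈ F then 1 else 0 := by
  simp [sqfreeExp, Finsupp.finsetSum_apply, Finsupp.single_apply]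

lemma support_sqfreeExp (F : Finset (Fin n)) : (sqfreeExp F).support = F := by
  ext j
  simp [sqfreeExp_apply]

lemma prod_X_eq_monomial (F : Finset (Fin n)) :
    (∏ j ∈ F, X j : MvPolynomial (Fin n) K) = monomial (sqfreeExp F) 1 := by
  rw [sqfreeExp, monomial_sum_one]
  rfl

lemma sqfreeExp_le_iff (F : Finset (Fin n)) (a : Fin n →₀ ℕ) :
    sqfreeExp F ≤ a ↔ F ⊆ a.support := by
  simp only [Finsupp.le_def, sqfreeExp_apply, Finset.subset_iff, Finsupp.mem_support_iff]
  refine forall_congr' fun j => ?_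
  split_ifs with h <;> simp [h, Nat.one_le_iff_ne_zero]

lemma mem_stanleyReisnerIdeal_iff {Δ : Complex n} {f : MvPolynomial (Fin n) K} :
    f ∈ stanleyReisnerIdeal K Δ ↔ ∀ a ∈ f.support, a.support ∉ Δ := by
  have h : stanleyReisnerIdeal K Δ = Ideal.span
      ((fun s => monomial s (1 : K)) '' {a | ∃ F : Finset (Fin n), F ∉ Δ ∧ a = sqfreeExp F}) := by
    unfold stanleyReisnerIdeal
    congr 1
    ext f
    simp only [Set.mem_ofPred_eq, Set.mem_image, prod_X_eq_monomial]
    constructor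
    · rintro ⟨F, hF, rfl⟩
      exact ⟨_, ⟨F, hF, rfl⟩, rfl⟩
    · rintro ⟨_, ⟨F, hF, rfl⟩, rfl⟩
      exact ⟨F, hF, rfl⟩
  rw [h, mem_ideal_span_monomial_image]
  refine forall₂_congr fun a _ => ?_
  constructor
  · rintro ⟨_, ⟨F, hF, rfl⟩, hle⟩ ha
    exact hF (Δ.lower ((sqfreeExp_le_iff F a).1 hle) ha)
  · exact fun ha => ⟨_, ⟨a.support, ha, rfl⟩, (sqfreeExp_le_iff _ a).2 subset_rfl⟩

lemma monomial_mem_stanleyReisnerIdeal {Δ : Complex n} {a : Fin n →₀ ℕ} (ha : a.support ∉ Δ)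
    (c : K) : monomial a c ∈ stanleyReisnerIdeal K Δ := by
  rw [mem_stanleyReisnerIdeal_iff]
  intro b hb
  rw [Finset.mem_singleton.1 (support_monomial_subset hb)]
  exact ha

/-- The squarefree monomial of a nonface, as an element of the Stanley–Reisner ideal. -/
noncomputable def nonfaceMonomial (K : Type*) [Field K] {Δ : Complex n} (F : Finset (Fin n))
    (hF : F ∉ Δ) : stanleyReisnerIdeal K Δ :=
  ⟨monomial (sqfreeExp F) 1,
    monomial_mem_stanleyReisnerIdeal (by rwa [support_sqfreeExp]) 1⟩

lemma hom_ext_minNonfaces {Δ : Complex n} {M : Type*} [AddCommGroup M]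
    [Module (MvPolynomial (Fin n) K) M]
    {φ : stanleyReisnerIdeal K Δ →ₗ[MvPolynomial (Fin n) K] M}
    (h : ∀ C (hC : C ∈ minNonfaces Δ), φ (nonfaceMonomial K C hC.1) = 0) : φ = 0 := by
  have h0 : ∀ f (hf : f ∈ stanleyReisnerIdeal K Δ), φ ⟨f, hf⟩ = 0 := by
    intro f hf
    induction hf using Submodule.span_induction with
    | mem f hf =>
      obtain ⟨F, hF, rfl⟩ := hf
      obtain ⟨C, hC, hCF⟩ := exists_minNonface_subset hF
      have : (⟨∏ j ∈ F, X j, Ideal.subset_span ⟨F, hF, rfl⟩⟩ : stanleyReisnerIdeal K Δ) =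
          (∏ j ∈ F \ C, X j : MvPolynomial (Fin n) K) • nonfaceMonomial K C hC.1 := by
        apply Subtype.ext
        change (_ : MvPolynomial (Fin n) K) =
          (∏ j ∈ F \ C, X j) * monomial (sqfreeExp C) 1
        rw [← prod_X_eq_monomial, Finset.prod_sdiff hCF]
      erw [this]
      rw [map_smul, h C hC, smul_zero]
    | zero => exact map_zero φ
    | add f g hf hg ihf ihg =>
      have := map_add φ ⟨f, hf⟩ ⟨g, hg⟩
      rw [ihf, ihg, add_zero] at this
      exact this
    | smul s f hf ih =>
      have := map_smul φ s ⟨f, hf⟩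
      rw [ih, smul_zero] at this
      exact this
  ext ⟨f, hf⟩
  exact h0 f hf

/-- The coefficient of the monomial `x^a`, for `a` supported on a face, as a functional on the
Stanley–Reisner ring. -/
noncomputable def faceCoeff (K : Type*) [Field K] {Δ : Complex n} (a : Fin n →₀ ℕ)
    (ha : a.support ∈ Δ) : (MvPolynomial (Fin n) K ⧸ stanleyReisnerIdeal K Δ) →ₗ[K] K :=
  ((stanleyReisnerIdeal K Δ).restrictScalars K).liftQ (lcoeff K a) (fun f hf => by
      by_contra h
      exact mem_stanleyReisnerIdeal_iff.1 hf a (mem_support_iff.2 h) ha) ∘ₗ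
    (Submodule.Quotient.restrictScalarsEquiv K (stanleyReisnerIdeal K Δ)).symm.toLinearMap

lemma faceCoeff_mk {Δ : Complex n} (a : Fin n →₀ ℕ) (ha : a.support ∈ Δ)
    (f : MvPolynomial (Fin n) K) :
    faceCoeff K a ha (Ideal.Quotient.mk (stanleyReisnerIdeal K Δ) f) = coeff a f := rfl

/-! ### Homogeneous components -/

lemma mem_polyComponent_iff {d : Fin n → ℤ} {f : MvPolynomial (Fin n) K} :
    f ∈ polyComponent K d ↔
      f = 0 ∨ ∃ (a : Fin n →₀ ℕ) (c : K), (∀ j, (a j : ℤ) = d j) ∧ f = monomial a c := by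
  constructor
  · intro hf
    by_cases h : ∃ a : Fin n →₀ ℕ, ∀ j, (a j : ℤ) = d j
    · obtain ⟨a, ha⟩ := h
      right
      have hle : polyComponent K d ≤ Submodule.span K {monomial a 1} := by
        refine Submodule.span_mono ?_
        rintro _ ⟨b, hb, rfl⟩
        have : b = a := Finsupp.ext fun j => by exact_mod_cast (hb j).trans (ha j).symm
        rw [this]
        rfl
      obtain ⟨c, rfl⟩ := Submodule.mem_span_singleton.1 (hle hf)
      exact ⟨a, c, ha, by rw [smul_monomial, smul_eq_mul, mul_one]⟩
    · left
      have : {f : MvPolynomial (Fin n) K |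
          ∃ a : Fin n →₀ ℕ, (∀ i, (a i : ℤ) = d i) ∧ f = monomial a 1} = ∅ :=
        Set.eq_empty_of_forall_notMem fun f ⟨a, ha, _⟩ => h ⟨a, ha⟩
      rw [polyComponent, this, Submodule.span_empty] at hf
      exact hf
  · rintro (rfl | ⟨a, c, ha, rfl⟩)
    · exact zero_mem _
    · have : monomial a c = c • (monomial a 1 : MvPolynomial (Fin n) K) := by
        rw [smul_monomial, smul_eq_mul, mul_one]
      rw [this]
      exact Submodule.smul_mem _ _ (Submodule.subset_span ⟨a, ha, rfl⟩)

lemma mk_monomial_mem_quotComponent (I : Ideal (MvPolynomial (Fin n) K)) {d : Fin n → ℤ}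
    {a : Fin n →₀ ℕ} (ha : ∀ j, (a j : ℤ) = d j) (c : K) :
    Ideal.Quotient.mk I (monomial a c) ∈ quotComponent I d :=
  ⟨_, mem_polyComponent_iff.2 (Or.inr ⟨a, c, ha, rfl⟩), rfl⟩

lemma sub_single_apply_eq {a : Fin n →₀ ℕ} {i : Fin n} (hi : a i ≠ 0) (j : Fin n) :
    ((a - Finsupp.single i 1 : Fin n →₀ ℕ) j : ℤ) =
      ((fun k => (a k : ℤ)) + -(Pi.single i 1 : Fin n → ℤ)) j := by
  rw [Pi.add_apply, Pi.neg_apply, Finsupp.tsub_apply]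
  by_cases h : j = i
  · subst h
    simp only [Finsupp.single_eq_same, Pi.single_eq_same]
    omega
  · rw [Pi.single_eq_of_ne h, Finsupp.single_eq_of_ne h]
    simp

lemma sqfreeExp_sub_single (C : Finset (Fin n)) (i : Fin n) :
    sqfreeExp C - Finsupp.single i 1 = sqfreeExp (C.erase i) := by
  ext j
  rw [Finsupp.tsub_apply, sqfreeExp_apply, sqfreeExp_apply, Finsupp.single_apply]
  simp only [Finset.mem_erase]
  grind

/-! ### Homomorphisms of degree `-e_i` -/

lemma erase_mem_of_minNonface {Δ : Complex n} {C : Finset (Fin n)} (hC : C ∈ minNonfaces Δ)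
    {i : Fin n} (hi : i ∈ C) : (sqfreeExp (C.erase i)).support ∈ Δ := by
  rw [support_sqfreeExp]
  exact hC.2 _ (Finset.erase_ssubset hi)

/-- The coefficients of `x_{C \ i}` in the images of the generators `x_C` with `i ∈ C`. -/
noncomputable def leadCoeffs (K : Type*) [Field K] (Δ : Complex n) (i : Fin n) :
    (stanleyReisnerIdeal K Δ →ₗ[MvPolynomial (Fin n) K]
      MvPolynomial (Fin n) K ⧸ stanleyReisnerIdeal K Δ) →ₗ[K]
      (minNonfacesContaining Δ {i} → K) where
  toFun φ C := faceCoeff K (sqfreeExp (C.1.erase i))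
    (erase_mem_of_minNonface C.2.1 (Finset.singleton_subset_iff.1 C.2.2))
    (φ (nonfaceMonomial K C.1 C.2.1.1))
  map_add' φ ψ := by
    ext C
    exact map_add _ _ _
  map_smul' c φ := by
    ext C
    exact (faceCoeff K _ _).map_smul c _

/-! ### The contribution of derivations -/

lemma derivation_prod_X (D : Derivation K (MvPolynomial (Fin n) K) (MvPolynomial (Fin n) K))
    (F : Finset (Fin n)) : D (∏ j ∈ F, X j) = ∑ j ∈ F, (∏ k ∈ F.erase j, X k) * D (X j) := by
  induction F using Finset.induction_on with
  | empty => simp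
  | insert i F hi ih =>
    rw [Finset.prod_insert hi, Derivation.leibniz, ih, Finset.sum_insert hi,
      Finset.erase_insert hi, smul_eq_mul, smul_eq_mul, Finset.mul_sum, add_comm]
    congr 1
    refine Finset.sum_congr rfl fun j hj => ?_
    have hij : i ≠ j := fun h => hi (h ▸ hj)
    rw [Finset.erase_insert_of_ne hij,
      Finset.prod_insert fun h => hi (Finset.mem_of_mem_erase h), mul_assoc]

/-- In the Leibniz expansion of `D x_C`, every term with `j ≠ i` is divisible by `x_i`, so only
`x_{C \ i} D(x_i)` can contribute. -/
lemma leadCoeffs_derToHom (Δ : Complex n) (i : Fin n)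
    (D : Derivation K (MvPolynomial (Fin n) K) (MvPolynomial (Fin n) K)) :
    leadCoeffs K Δ i (derToHom _ D) = fun _ => coeff 0 (D (X i)) := by
  ext C
  have hi : i ∈ C.1 := Finset.singleton_subset_iff.1 C.2.2
  change coeff (sqfreeExp (C.1.erase i)) (D (monomial (sqfreeExp C.1) 1)) = _
  rw [← prod_X_eq_monomial, derivation_prod_X, coeff_sum, Finset.sum_eq_single i]
  · rw [prod_X_eq_monomial]
    have := coeff_monomial_mul (0 : Fin n →₀ ℕ) (sqfreeExp (C.1.erase i)) (1 : K) (D (X i))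
    rwa [add_zero, one_mul] at this
  · intro j hj hji
    rw [prod_X_eq_monomial, coeff_monomial_mul', if_neg]
    rw [sqfreeExp_le_iff, support_sqfreeExp]
    intro hs
    have := hs (Finset.mem_erase.2 ⟨hji.symm, hi⟩)
    simp at this
  · exact fun h => absurd hi h

lemma leadCoeffs_pderiv (Δ : Complex n) (i : Fin n) :
    leadCoeffs K Δ i (derToHom _ (pderiv i)) = fun _ => 1 := by
  rw [leadCoeffs_derToHom, pderiv_X_self, coeff_zero_one]

lemma derToHom_pderiv_mem (I : Ideal (MvPolynomial (Fin n) K)) (i : Fin n) :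
    derToHom I (pderiv i) ∈ homComponent I (-(Pi.single i 1)) := by
  intro d f hf
  change Ideal.Quotient.mk I (pderiv i (f : MvPolynomial (Fin n) K)) ∈ _
  rcases mem_polyComponent_iff.1 hf with h | ⟨a, c, ha, h⟩
  · rw [h, map_zero, map_zero]
    exact zero_mem _
  · rw [h, pderiv_monomial]
    by_cases hi : a i = 0
    · rw [hi, Nat.cast_zero, mul_zero, monomial_zero, map_zero]
      exact zero_mem _
    · refine mk_monomial_mem_quotComponent I (fun j => ?_) _
      rw [sub_single_apply_eq hi, show (fun k => (a k : ℤ)) = d from funext ha]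

lemma exists_eq_monomial_of_mem_homComponent {Δ : Complex n} {i : Fin n}
    {φ : stanleyReisnerIdeal K Δ →ₗ[MvPolynomial (Fin n) K]
      MvPolynomial (Fin n) K ⧸ stanleyReisnerIdeal K Δ}
    (hφ : φ ∈ homComponent (stanleyReisnerIdeal K Δ) (-(Pi.single i 1)))
    {C : Finset (Fin n)} (hC : C ∉ Δ) :
    ∃ c : K, (i ∉ C → c = 0) ∧ φ (nonfaceMonomial K C hC) =
      Ideal.Quotient.mk _ (monomial (sqfreeExp (C.erase i)) c) := by
  obtain ⟨g, hg, hgφ⟩ := hφ (fun j => (sqfreeExp C j : ℤ)) (nonfaceMonomial K C hC)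
    (mem_polyComponent_iff.2 (Or.inr ⟨_, 1, fun _ => rfl, rfl⟩))
  rw [← hgφ]
  rcases mem_polyComponent_iff.1 hg with rfl | ⟨a, c, ha, rfl⟩
  · exact ⟨0, fun _ => rfl, by rw [monomial_zero]; rfl⟩
  · have hi : i ∈ C := by
      by_contra hi
      have := ha i
      simp [sqfreeExp_apply, hi] at this
    have : a = sqfreeExp (C.erase i) := by
      rw [← sqfreeExp_sub_single]
      ext j
      have h1 := sub_single_apply_eq (a := sqfreeExp C) (i := i)
        (by simp [sqfreeExp_apply, hi]) j
      exact_mod_cast (ha j).trans h1.symm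
    subst this
    exact ⟨c, fun h => absurd hi h, rfl⟩

lemma eq_zero_of_leadCoeffs_eq_zero {Δ : Complex n} {i : Fin n}
    {φ : stanleyReisnerIdeal K Δ →ₗ[MvPolynomial (Fin n) K]
      MvPolynomial (Fin n) K ⧸ stanleyReisnerIdeal K Δ}
    (hφ : φ ∈ homComponent (stanleyReisnerIdeal K Δ) (-(Pi.single i 1)))
    (h : leadCoeffs K Δ i φ = 0) : φ = 0 := by
  refine hom_ext_minNonfaces fun C hC => ?_
  obtain ⟨c, hc, hφC⟩ := exists_eq_monomial_of_mem_homComponent hφ hC.1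
  have hc0 : c = 0 := by
    by_cases hi : i ∈ C
    · have h1 : faceCoeff K (sqfreeExp (C.erase i)) (erase_mem_of_minNonface hC hi)
          (φ (nonfaceMonomial K C hC.1)) = 0 :=
        congrFun h ⟨C, hC, Finset.singleton_subset_iff.2 hi⟩
      rwa [hφC, faceCoeff_mk, coeff_monomial, if_pos rfl] at h1
    · exact hc hi
  rw [hφC, hc0, monomial_zero, map_zero]

/-- With `U = C ∪ D`, the image of `x_U` is both `λ_C x_{U \ i}` and `λ_D x_{U \ i}`, and `x_{U \
i}` is nonzero modulo the ideal because `U \ i` is a face. -/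
lemma leadCoeffs_eq_of_union_erase_mem {Δ : Complex n} {i : Fin n}
    {φ : stanleyReisnerIdeal K Δ →ₗ[MvPolynomial (Fin n) K]
      MvPolynomial (Fin n) K ⧸ stanleyReisnerIdeal K Δ}
    (hφ : φ ∈ homComponent (stanleyReisnerIdeal K Δ) (-(Pi.single i 1)))
    (C D : minNonfacesContaining Δ {i}) (h : (C.1 ∪ D.1).erase i ∈ Δ) :
    leadCoeffs K Δ i φ C = leadCoeffs K Δ i φ D := by
  have key : ∀ (E : minNonfacesContaining Δ {i}) (U : Finset (Fin n)) (hU : U ∉ Δ)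
      (hUi : (sqfreeExp (U.erase i)).support ∈ Δ), E.1 ⊆ U → leadCoeffs K Δ i φ E =
        faceCoeff K (sqfreeExp (U.erase i)) hUi (φ (nonfaceMonomial K U hU)) := by
    intro E U hU hUi hEU
    have hi : i ∈ E.1 := Finset.singleton_subset_iff.1 E.2.2
    have h1 : nonfaceMonomial K U hU =
        (∏ j ∈ U \ E.1, X j : MvPolynomial (Fin n) K) • nonfaceMonomial K E.1 E.2.1.1 := by
      apply Subtype.ext
      change (monomial (sqfreeExp U) 1 : MvPolynomial (Fin n) K) =
        (∏ j ∈ U \ E.1, X j) * monomial (sqfreeExp E.1) 1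
      rw [← prod_X_eq_monomial, ← prod_X_eq_monomial, Finset.prod_sdiff hEU]
    obtain ⟨c, -, hc⟩ := exists_eq_monomial_of_mem_homComponent hφ E.2.1.1
    have h2 : leadCoeffs K Δ i φ E = c := by
      change faceCoeff K _ (erase_mem_of_minNonface E.2.1 hi)
        (φ (nonfaceMonomial K E.1 E.2.1.1)) = c
      rw [hc, faceCoeff_mk, coeff_monomial, if_pos rfl]
    have h3 : sqfreeExp (U \ E.1) + sqfreeExp (E.1.erase i) = sqfreeExp (U.erase i) := by
      ext j
      simp only [Finsupp.add_apply, sqfreeExp_apply, Finset.mem_sdiff, Finset.mem_erase]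
      have := @hEU j
      grind
    rw [h2, h1, map_smul, hc, prod_X_eq_monomial]
    change c = faceCoeff K _ hUi (Ideal.Quotient.mk _
      (monomial (sqfreeExp (U \ E.1)) 1 * monomial (sqfreeExp (E.1.erase i)) c))
    rw [faceCoeff_mk, monomial_mul, h3, coeff_monomial, if_pos rfl, one_mul]
  have hU : C.1 ∪ D.1 ∉ Δ := fun hU => C.2.1.1 (Δ.lower Finset.subset_union_left hU)
  have hUi : (sqfreeExp ((C.1 ∪ D.1).erase i)).support ∈ Δ := by rwa [support_sqfreeExp]
  rw [key C _ hU hUi Finset.subset_union_left, key D _ hU hUi Finset.subset_union_right]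

/-! ### Homomorphisms built from circuit elimination -/

/-- The `K`-linear map sending `x^a` to the class of `x^(a - e_i)` if `C` is contained in the
support of `a`, and to zero otherwise. -/
noncomputable def shiftMap (I : Ideal (MvPolynomial (Fin n) K)) (i : Fin n)
    (C : Finset (Fin n)) : MvPolynomial (Fin n) K →ₗ[K] MvPolynomial (Fin n) K ⧸ I :=
  (basisMonomials (Fin n) K).constr K fun a =>
    if C ⊆ a.support then Ideal.Quotient.mk I (monomial (a - Finsupp.single i 1) 1) else 0

lemma shiftMap_monomial (I : Ideal (MvPolynomial (Fin n) K)) (i : Fin n) (C : Finset (Fin n))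
    (a : Fin n →₀ ℕ) (c : K) : shiftMap I i C (monomial a c) =
      if C ⊆ a.support then Ideal.Quotient.mk I (monomial (a - Finsupp.single i 1) c) else 0 := by
  have h : ∀ b : Fin n →₀ ℕ, monomial b c = c • (basisMonomials (Fin n) K b) := fun b => by
    rw [coe_basisMonomials, smul_monomial, smul_eq_mul, mul_one]
  rw [h a, map_smul, shiftMap, Module.Basis.constr_basis]
  split_ifs
  · rw [h, coe_basisMonomials]
    rfl
  · exact smul_zero _

lemma shiftMap_mul {Δ : Complex n} {i : Fin n} (h : EliminationAt Δ i) {C : Finset (Fin n)}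
    (hC : C ∈ minNonfaces Δ) (hi : i ∈ C) (s f : MvPolynomial (Fin n) K)
    (hf : f ∈ stanleyReisnerIdeal K Δ) :
    shiftMap (stanleyReisnerIdeal K Δ) i C (s * f) =
      s • shiftMap (stanleyReisnerIdeal K Δ) i C f := by
  have key : ∀ (b : Fin n →₀ ℕ) (r : K) (a : Fin n →₀ ℕ) (c : K), a.support ∉ Δ →
      shiftMap (stanleyReisnerIdeal K Δ) i C (monomial b r * monomial a c) =
        monomial b r • shiftMap (stanleyReisnerIdeal K Δ) i C (monomial a c) := by
    intro b r a c ha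
    rw [monomial_mul, shiftMap_monomial, shiftMap_monomial]
    have hsupp : ∀ j, j ∈ (b + a).support ↔ j ∈ b.support ∨ j ∈ a.support := fun j => by
      simp only [Finsupp.mem_support_iff, Finsupp.add_apply]
      omega
    by_cases h1 : C ⊆ a.support
    · have h2 : C ⊆ (b + a).support := fun j hj => (hsupp j).2 (Or.inr (h1 hj))
      rw [if_pos h1, if_pos h2]
      have hai : Finsupp.single i 1 ≤ a := by
        rw [Finsupp.single_le_iff]
        exact Nat.one_le_iff_ne_zero.2 (Finsupp.mem_support_iff.1 (h1 hi))
      rw [add_tsub_assoc_of_le hai, ← monomial_mul, map_mul]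
      rfl
    · rw [if_neg h1, smul_zero]
      split_ifs with h2
      -- The critical case: `C` divides the product but not `x^a`. The shifted product must lie in
      -- the ideal. A circuit `D` dividing `x^a` survives the shift if `i ∉ D`; otherwise `D ≠ C`,
      -- and elimination supplies the nonface `(C ∪ D) \ i`.
      · refine Ideal.Quotient.eq_zero_iff_mem.2 (monomial_mem_stanleyReisnerIdeal ?_ _)
        have hmem : ∀ j, j ≠ i → j ∈ (b + a).support →
            j ∈ (b + a - Finsupp.single i 1).support := fun j hji hj => by
          rw [Finsupp.mem_support_iff] at hj ⊢
          rwa [Finsupp.tsub_apply, Finsupp.single_eq_of_ne hji, tsub_zero]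
        obtain ⟨D, hD, hDa⟩ := exists_minNonface_subset ha
        have hD' : ∀ j ∈ D, j ∈ (b + a).support := fun j hj => (hsupp j).2 (Or.inr (hDa hj))
        intro hΔ
        by_cases hiD : i ∈ D
        · refine h C hC D hD hi hiD (fun he => h1 (he ▸ hDa)) (Δ.lower (fun j hj => ?_) hΔ)
          rw [Finset.mem_erase, Finset.mem_union] at hj
          exact hmem j hj.1 (hj.2.elim (fun hj => h2 hj) (hD' j))
        · exact hD.1 (Δ.lower (fun j hj => hmem j (fun he => hiD (he ▸ hj)) (hD' j hj)) hΔ)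
      · rfl
  have key' : ∀ (a : Fin n →₀ ℕ) (c : K), a.support ∉ Δ →
      shiftMap (stanleyReisnerIdeal K Δ) i C (s * monomial a c) =
        s • shiftMap (stanleyReisnerIdeal K Δ) i C (monomial a c) := by
    intro a c ha
    induction s using MvPolynomial.induction_on' with
    | monomial b r => exact key b r a c ha
    | add p q hp hq => rw [add_mul, map_add, hp, hq, add_smul]
  rw [f.as_sum, Finset.mul_sum, map_sum, map_sum, Finset.smul_sum]
  exact Finset.sum_congr rfl fun a ha => key' a _ (mem_stanleyReisnerIdeal_iff.1 hf a ha)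

/-- The homomorphism of degree `-e_i` that maps `x_C` to `x_{C \ i}` and every other generator of
the Stanley–Reisner ideal to zero. -/
noncomputable def shiftHom (K : Type*) [Field K] {Δ : Complex n} {i : Fin n}
    (h : EliminationAt Δ i) {C : Finset (Fin n)} (hC : C ∈ minNonfaces Δ) (hi : i ∈ C) :
    stanleyReisnerIdeal K Δ →ₗ[MvPolynomial (Fin n) K]
      MvPolynomial (Fin n) K ⧸ stanleyReisnerIdeal K Δ where
  toFun f := shiftMap (stanleyReisnerIdeal K Δ) i C f
  map_add' _ _ := map_add _ _ _
  map_smul' s f := shiftMap_mul h hC hi s f f.2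

lemma shiftHom_mem {Δ : Complex n} {i : Fin n} (h : EliminationAt Δ i) {C : Finset (Fin n)}
    (hC : C ∈ minNonfaces Δ) (hi : i ∈ C) :
    shiftHom K h hC hi ∈ homComponent (stanleyReisnerIdeal K Δ) (-(Pi.single i 1)) := by
  intro d f hf
  change shiftMap (stanleyReisnerIdeal K Δ) i C (f : MvPolynomial (Fin n) K) ∈ _
  rcases mem_polyComponent_iff.1 hf with h | ⟨a, c, ha, h⟩
  · rw [h, map_zero]
    exact zero_mem _
  · rw [h, shiftMap_monomial]
    split_ifs with hs
    · refine mk_monomial_mem_quotComponent _ (fun j => ?_) _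
      rw [sub_single_apply_eq (Finsupp.mem_support_iff.1 (hs hi)),
        show (fun k => (a k : ℤ)) = d from funext ha]
    · exact zero_mem _

open Classical in
lemma leadCoeffs_shiftHom {Δ : Complex n} {i : Fin n} (h : EliminationAt Δ i)
    (C : minNonfacesContaining Δ {i}) :
    leadCoeffs K Δ i (shiftHom K h C.2.1 (Finset.singleton_subset_iff.1 C.2.2)) =
      Pi.single C 1 := by
  ext D
  change faceCoeff K (sqfreeExp (D.1.erase i))
    (erase_mem_of_minNonface D.2.1 (Finset.singleton_subset_iff.1 D.2.2))
    (shiftMap (stanleyReisnerIdeal K Δ) i C.1 (monomial (sqfreeExp D.1) 1)) = _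
  rw [shiftMap_monomial, support_sqfreeExp, sqfreeExp_sub_single]
  by_cases hCD : C = D
  · subst hCD
    rw [if_pos subset_rfl, faceCoeff_mk, coeff_monomial, if_pos rfl, Pi.single_eq_same]
  · rw [if_neg fun hs => hCD (Subtype.ext (minNonface_eq_of_subset D.2.1 C.2.1.1 hs)),
      map_zero, Pi.single_eq_of_ne (Ne.symm hCD)]

/-! ### Surjectivity of `leadCoeffs` and the dimension count -/

lemma map_leadCoeffs_eq_top_iff (Δ : Complex n) (i : Fin n) :
    (homComponent (stanleyReisnerIdeal K Δ) (-(Pi.single i 1))).map (leadCoeffs K Δ i) = ⊤ ↔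
      EliminationAt Δ i := by
  classical
  constructor
  · intro htop C hC D hD hiC hiD hne hU
    let C' : minNonfacesContaining Δ {i} := ⟨C, hC, Finset.singleton_subset_iff.2 hiC⟩
    let D' : minNonfacesContaining Δ {i} := ⟨D, hD, Finset.singleton_subset_iff.2 hiD⟩
    have hmem : (Pi.single C' 1 : minNonfacesContaining Δ {i} → K) ∈
        (homComponent (stanleyReisnerIdeal K Δ) (-(Pi.single i 1))).map (leadCoeffs K Δ i) := by
      rw [htop]
      trivial
    obtain ⟨φ, hφ, he⟩ := hmem
    have h1 := leadCoeffs_eq_of_union_erase_mem hφ C' D' hU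
    rw [he, Pi.single_eq_same,
      Pi.single_eq_of_ne (fun h => hne (congrArg Subtype.val h).symm)] at h1
    exact one_ne_zero h1
  · intro h
    have : Fintype (minNonfacesContaining Δ {i}) := Fintype.ofFinite _
    rw [eq_top_iff, ← (Pi.basisFun K (minNonfacesContaining Δ {i})).span_eq, Submodule.span_le]
    rintro _ ⟨C, rfl⟩
    rw [Pi.basisFun_apply]
    exact ⟨_, shiftHom_mem h C.2.1 (Finset.singleton_subset_iff.1 C.2.2),
      leadCoeffs_shiftHom h C⟩

lemma rank_T1Component_eq_iff (Δ : Complex n) (i : Fin n) :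
    Module.rank K (T1Component (stanleyReisnerIdeal K Δ) (-(Pi.single i 1))) =
        ((max ((minNonfacesContaining Δ {i}).ncard - 1) 0 : ℕ) : Cardinal) ↔
      EliminationAt Δ i := by
  have : Fintype (minNonfacesContaining Δ {i}) := Fintype.ofFinite _
  obtain ⟨r, hr, hsum⟩ := rank_map_add_finrank_span
    ((LinearMap.range (derToHom (stanleyReisnerIdeal K Δ))).mkQ.restrictScalars K)
    (leadCoeffs K Δ i) (homComponent (stanleyReisnerIdeal K Δ) (-(Pi.single i 1)))
    (fun φ => eq_zero_of_leadCoeffs_eq_zero) _ (derToHom_pderiv_mem _ i)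
    ((Submodule.Quotient.mk_eq_zero _).2 ⟨_, rfl⟩) (fun φ hφ => by
      obtain ⟨D, rfl⟩ := (Submodule.Quotient.mk_eq_zero _).1 hφ
      rw [leadCoeffs_pderiv, leadCoeffs_derToHom, Submodule.mem_span_singleton]
      exact ⟨coeff 0 (D (X i)), funext fun _ => mul_one _⟩)
  have hcard : Module.finrank K (minNonfacesContaining Δ {i} → K) =
      (minNonfacesContaining Δ {i}).ncard := by
    rw [Module.finrank_fintype_fun_eq_card, ← Nat.card_coe_set_eq, Nat.card_eq_fintype_card]
  rw [T1Component, hr, Nat.cast_inj, Nat.max_zero, ← map_leadCoeffs_eq_top_iff (K := K)]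
  rw [leadCoeffs_pderiv] at hsum
  have htop : (homComponent (stanleyReisnerIdeal K Δ) (-(Pi.single i 1))).map
      (leadCoeffs K Δ i) = ⊤ ↔ Module.finrank K ((homComponent (stanleyReisnerIdeal K Δ)
        (-(Pi.single i 1))).map (leadCoeffs K Δ i)) = (minNonfacesContaining Δ {i}).ncard := by
    rw [← hcard]
    exact ⟨fun h => by rw [h, finrank_top], Submodule.eq_top_of_finrank_eq⟩
  have hle := Submodule.finrank_le ((homComponent (stanleyReisnerIdeal K Δ)
    (-(Pi.single i 1))).map (leadCoeffs K Δ i))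
  rw [hcard] at hle
  rw [htop]
  -- With no circuit through `i` all dimensions are zero, matching the truncated `0 - 1 = 0`;
  -- otherwise the constant vectors form a line and account for the `-1`.
  rcases (minNonfacesContaining Δ {i}).eq_empty_or_nonempty with he | hne
  · have h0 : (minNonfacesContaining Δ {i}).ncard = 0 := by rw [he, Set.ncard_empty]
    omega
  · have hpos := (Set.ncard_pos).2 hne
    have h1 : (fun _ => 1 : minNonfacesContaining Δ {i} → K) ≠ 0 := fun h =>
      one_ne_zero (congrFun h ⟨_, hne.some_mem⟩)
    rw [finrank_span_singleton h1] at hsum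
    omega

end Algebra

end CotangentMatroid

theorem mainTheorem2 (K : Type*) [Field K] (n : ℕ) (Δ : CotangentMatroid.Complex n)
    (hΔ : (Δ : Set (Finset (Fin n))).Nonempty) :
    CotangentMatroid.IsMatroid Δ ↔
      ∀ i : Fin n,
        Module.rank K
            (CotangentMatroid.T1Component (CotangentMatroid.stanleyReisnerIdeal K Δ)
              (-(Pi.single i 1))) =
          ((max ((CotangentMatroid.minNonfacesContaining Δ {i}).ncard - 1) 0 : ℕ) : Cardinal) := by
  simp only [CotangentMatroid.rank_T1Component_eq_iff]
  exact ⟨fun h i => h.eliminationAt i, CotangentMatroid.isMatroid_of_eliminationAt hΔ⟩
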